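/- Let $n\ge 1$ and $p\ge 0$ be integers, let $Q\in\mathbb R^{n\times n}$ be symmetric positive definite, $b_0,b_1,\dots,b_p\in\mathbb R^n$, $d_0,d_1,\dots,d_p\in\mathbb R$, and let $l_i,u_i\in[-\infty,+\infty]$ for $i=1,\dots,p$. Put $f_i(x)=x^TQx+2b_i^Tx+d_i$ for $i=0,1,\dots,p$, and let $v(\cdot)$ denote the optimal value (in $[-\infty,+\infty]$) of a problem. Consider the problem $$({\rm UQ}_+)\quad \max_{x\in\mathbb R^n}\ f_0(x)\quad\text{s.t. } l_i\le f_i(x)\le u_i,\ i=1,\dots,p,$$ its second-order cone relaxation $$({\rm SOCP})\quad \max_{x\in\mathbb R^n,\,t\in\mathbb R}\ t+2b_0^Tx+d_0\quad\text{s.t. } l_i\le t+2b_i^Tx+d_i\le u_i\ (i=1,\dots,p),\quad \left\|\begin{pmatrix}Q^{1/2}x\\ \frac{t-1}{2}\end{pmatrix}\right\|\le\frac{t+1}{2},$$ its primal semidefinite relaxation, over $Y\in\mathbb R^{n\times n}$ and $x\in\mathbb R^n$ (with $A\bullet B={\rm Tr}(AB^T)$), $$(\text{P-SDP}_1)\quad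 \max\ \begin{pmatrix}Q&b_0\\b_0^T&d_0\end{pmatrix}\bullet\begin{pmatrix}Y&x\\x^T&1\end{pmatrix}\quad\text{s.t. } l_i\le\begin{pmatrix}Q&b_i\\b_i^T&d_i\end{pmatrix}\bullet\begin{pmatrix}Y&x\\x^T&1\end{pmatrix}\le u_i\ (i=1,\dots,p),\quad \begin{pmatrix}Y&x\\x^T&1\end{pmatrix}\succeq0,$$ and the dual semidefinite problem, over $\tau\in\mathbb R$ and $\lambda\in\mathbb R^p$, $$(\text{D-SDP})\quad \inf\ \tau+\sum_{i=1}^p(\lambda_i^+u_i-\lambda_i^-l_i)\quad\text{s.t. } \sum_{i=1}^p\lambda_i\begin{pmatrix}Q&b_i\\b_i^T&d_i\end{pmatrix}-\begin{pmatrix}Q&b_0\\b_0^T&d_0\end{pmatrix}+\begin{pmatrix}0&0\\0&\tau\end{pmatrix}\succeq0,$$ where $\lambda_i^+=\max\{\lambda_i,0\}$, $\lambda_i^-=-\min\{\lambda_i,0\}$ and $0\cdot(\pm\infty)=0$. Suppose that $({\rm UQ}_+)$ satisfies the Slater condition, i.e. there is $x\in\mathbb R^n$ with $l_i<f_i(x)<u_i$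 for all $i=1,\dots,p$, and that $v({\rm UQ}_+)<+\infty$. Then $$v({\rm SOCP})=v(\text{P-SDP}_1)=v(\text{D-SDP}).$$ If, in addition, ${\rm rank}[b_1,\dots,b_p]\le n-1$ or $p=n$, then strong duality holds: $v({\rm UQ}_+)=v(\text{D-SDP})$. -/

import Mathlib

open scoped MatrixOrder

noncomputable section

/-- The data of a uniform quadratic problem in `n` variables with `p` two-sided constraints
`l i ≤ xᵀQx + 2 (b i)ᵀx + d i ≤ u i` and objective `xᵀQx + 2 b0ᵀx + d0`.
The bounds may be infinite. Pure data: positive definiteness of `Q` is not part of it. -/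
structure UQ (n p : ℕ) where
  Q : Matrix (Fin n) (Fin n) ℝ
  b0 : Fin n → ℝ
  d0 : ℝ
  b : Fin p → Fin n → ℝ
  d : Fin p → ℝ
  l : Fin p → EReal
  u : Fin p → EReal

namespace UQ

variable {n p : ℕ} (P : UQ n p)

/-- The objective `f₀(x) = xᵀQx + 2 b0ᵀx + d0`. -/
def f0 (x : Fin n → ℝ) : ℝ :=
  x ⬝ᵥ (P.Q.mulVec x) + 2 * (P.b0 ⬝ᵥ x) + P.d0

/-- The constraint functions `fᵢ(x) = xᵀQx + 2 bᵢᵀx + dᵢ`. -/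
def f (i : Fin p) (x : Fin n → ℝ) : ℝ :=
  x ⬝ᵥ (P.Q.mulVec x) + 2 * (P.b i ⬝ᵥ x) + P.d i

/-- Feasible points of the problem. -/
def Feasible (x : Fin n → ℝ) : Prop :=
  ∀ i, P.l i ≤ (P.f i x : EReal) ∧ (P.f i x : EReal) ≤ P.u i

/-- Slater condition: some point satisfies every inequality constraint strictly. -/
def Slater : Prop :=
  ∃ x : Fin n → ℝ, ∀ i, P.l i < (P.f i x : EReal) ∧ (P.f i x : EReal) < P.u i

/-- Optimal value of the maximization problem (`⊥` if it is infeasible). -/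
def value : EReal :=
  ⨆ (x : Fin n → ℝ) (_ : P.Feasible x), (P.f0 x : EReal)

/-- Feasible points `(x, t)` of the second-order cone relaxation:
`l i ≤ t + 2 bᵢᵀx + dᵢ ≤ u i` and `‖(Q^{1/2} x, (t-1)/2)‖ ≤ (t+1)/2` (Euclidean norm). -/
def SOCPFeasible (x : Fin n → ℝ) (t : ℝ) : Prop :=
  (∀ i, P.l i ≤ ((t + 2 * (P.b i ⬝ᵥ x) + P.d i : ℝ) : EReal) ∧
    ((t + 2 * (P.b i ⬝ᵥ x) + P.d i : ℝ) : EReal) ≤ P.u i) ∧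
  ‖(WithLp.toLp 2 (Sum.elim ((CFC.sqrt P.Q).mulVec x) (fun _ => (t - 1) / 2)) :
    EuclideanSpace ℝ (Fin n ⊕ Unit))‖ ≤ (t + 1) / 2

/-- Optimal value of the second-order cone relaxation. -/
def valueSOCP : EReal :=
  ⨆ (x : Fin n → ℝ) (t : ℝ) (_ : P.SOCPFeasible x t),
    ((t + 2 * (P.b0 ⬝ᵥ x) + P.d0 : ℝ) : EReal)

/-- The symmetric block matrix with blocks `A`, `v`, `vᵀ`, `c`. -/
def bordered (A : Matrix (Fin n) (Fin n) ℝ) (v : Fin n → ℝ) (c : ℝ) :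
    Matrix (Fin n ⊕ Unit) (Fin n ⊕ Unit) ℝ :=
  Matrix.fromBlocks A (Matrix.replicateCol Unit v) (Matrix.replicateRow Unit v)
    (Matrix.of fun _ _ => c)

/-- The inner product `A • B = Tr(A Bᵀ)` of real matrices. -/
def matInner {m : Type*} [Fintype m] (A B : Matrix m m ℝ) : ℝ :=
  (A * B.transpose).trace

/-- Feasible points `(Y, x)` of the primal semidefinite relaxation. -/
def PSDPFeasible (Y : Matrix (Fin n) (Fin n) ℝ) (x : Fin n → ℝ) : Prop :=
  (∀ i, P.l i ≤ (matInner (bordered P.Q (P.b i) (P.d i)) (bordered Y x 1) : EReal) ∧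
    (matInner (bordered P.Q (P.b i) (P.d i)) (bordered Y x 1) : EReal) ≤ P.u i) ∧
  (bordered Y x 1).PosSemidef

/-- Optimal value of the primal semidefinite relaxation. -/
def valuePSDP : EReal :=
  ⨆ (Y : Matrix (Fin n) (Fin n) ℝ) (x : Fin n → ℝ) (_ : P.PSDPFeasible Y x),
    (matInner (bordered P.Q P.b0 P.d0) (bordered Y x 1) : EReal)

/-- Feasible points `(τ, y)` of the dual semidefinite problem (`y` are the free multipliers):
`∑ yᵢ [Q bᵢ; bᵢᵀ dᵢ] - [Q b0; b0ᵀ d0] + [0 0; 0 τ] ⪰ 0`. -/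
def DSDPFeasible (τ : ℝ) (y : Fin p → ℝ) : Prop :=
  ((∑ i, y i • bordered P.Q (P.b i) (P.d i)) - bordered P.Q P.b0 P.d0
    + bordered 0 0 τ).PosSemidef

/-- The dual objective `τ + ∑ (yᵢ⁺ uᵢ - yᵢ⁻ lᵢ)` with `yᵢ⁺ = max yᵢ 0`, `yᵢ⁻ = -min yᵢ 0`,
as an extended real, with the convention `0 * (±∞) = 0`. -/
def dualObj (τ : ℝ) (y : Fin p → ℝ) : EReal :=
  (τ : EReal) + ∑ i, (((max (y i) 0 : ℝ) : EReal) * P.u i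
    - ((-min (y i) 0 : ℝ) : EReal) * P.l i)

/-- Optimal value of the dual semidefinite problem. -/
def valueDSDP : EReal :=
  ⨅ (τ : ℝ) (y : Fin p → ℝ) (_ : P.DSDPFeasible τ y), P.dualObj τ y

end UQ

end

open Matrix

namespace UQ

variable {n p : ℕ} (P : UQ n p)

/-! ### Quadratic forms and trace products of bordered matrices. -/

section Bordered

variable (A B : Matrix (Fin n) (Fin n) ℝ) (v w : Fin n → ℝ) (c e : ℝ)

/-! All `f0` and `f i` share the quadratic part xᵀQx. Writing t for it makes objective and
constraints affine in (x, t), and relaxing t = xᵀQx to xᵀQx ≤ t gives a convex program: this is the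
SOCP, and `PSDP` is the same program with t = Q • Y (`valueSOCP_eq_valuePSDP`).

Weak duality is nonnegativity of the trace product of semidefinite matrices. Conversely, Slater
gives multipliers for the SOCP (`ConvexOn.exists_lagrange_multipliers`). Their Lagrangian is affine
in (x, t) and nonnegative on the epigraph, and homogenizing it yields the dual matrix inequality
(`posSemidef_bordered_of_nonneg`).

The relaxation is tight once some direction (w, s), w ≠ 0, leaves every constraint value fixed:
along it xᵀQx grows quadratically and t only linearly, so the ray hits the paraboloid. The rank
condition or p = n supplies such a direction (`exists_direction`). -/

theorem isHermitian_bordered (hA : A.IsHermitian) : (bordered A v c).IsHermitian := by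
  unfold bordered
  rw [isHermitian_fromBlocks_iff]
  refine ⟨hA, ?_, ?_, ?_⟩
  · ext i j; simp
  · ext i j; simp
  · ext i j; simp

theorem dotProduct_bordered_mulVec (z : Fin n ⊕ Unit → ℝ) :
    z ⬝ᵥ (bordered A w c) *ᵥ z =
      (z ∘ Sum.inl) ⬝ᵥ A *ᵥ (z ∘ Sum.inl) + 2 * z (Sum.inr ()) * (w ⬝ᵥ (z ∘ Sum.inl))
        + c * z (Sum.inr ()) ^ 2 := by
  have h : (z ∘ Sum.inl) ⬝ᵥ (fun i => w i * z (Sum.inr ())) =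
      z (Sum.inr ()) * (w ⬝ᵥ (z ∘ Sum.inl)) := by
    simp only [dotProduct, Finset.mul_sum]
    exact Finset.sum_congr rfl fun i _ => by ring
  have h2 : z ⬝ᵥ (bordered A w c) *ᵥ z =
      (z ∘ Sum.inl) ⬝ᵥ (A *ᵥ (z ∘ Sum.inl) + fun i => w i * z (Sum.inr ())) +
        z (Sum.inr ()) * (w ⬝ᵥ (z ∘ Sum.inl) + c * z (Sum.inr ())) := by
    simp [bordered, dotProduct, mulVec, Fintype.sum_sum_type]
  rw [h2, dotProduct_add, h]
  ring

theorem matInner_bordered :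
    matInner (bordered A v c) (bordered B w e) = matInner A B + 2 * (v ⬝ᵥ w) + c * e := by
  simp [matInner, bordered, trace, Matrix.mul_apply, Fintype.sum_sum_type, dotProduct,
    Finset.sum_add_distrib]
  ring

end Bordered

/-- The trace inner product of two positive semidefinite matrices is nonnegative. -/
theorem matInner_nonneg {m : Type*} [Fintype m] [DecidableEq m] {A B : Matrix m m ℝ}
    (hA : A.PosSemidef) (hB : B.PosSemidef) : 0 ≤ matInner A B := by
  -- By cyclicity Tr(AB) = Tr(B^{1/2} A B^{1/2}), the trace of a semidefinite matrix.
  have hs := (CFC.sqrt_nonneg B).posSemidef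
  have h := (hA.mul_mul_conjTranspose_same (CFC.sqrt B)).trace_nonneg
  rw [hs.1.eq, trace_mul_comm, ← Matrix.mul_assoc, trace_mul_comm,
    CFC.sqrt_mul_sqrt_self B hB.nonneg] at h
  rwa [matInner, ← conjTranspose_eq_transpose_of_trivial, hB.1.eq]

theorem matInner_vecMulVec (A : Matrix (Fin n) (Fin n) ℝ) (x : Fin n → ℝ) :
    matInner A (vecMulVec x x) = x ⬝ᵥ A *ᵥ x := by
  rw [matInner, transpose_vecMulVec, trace_mul_comm, vecMulVec_mul, trace_vecMulVec,
    dotProduct_mulVec, dotProduct_comm]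

theorem matInner_add {m : Type*} [Fintype m] (A B C : Matrix m m ℝ) :
    matInner A (B + C) = matInner A B + matInner A C := by
  simp [matInner, Matrix.mul_add]

theorem add_matInner {m : Type*} [Fintype m] (A B C : Matrix m m ℝ) :
    matInner (A + B) C = matInner A C + matInner B C := by
  simp [matInner, Matrix.add_mul]

theorem matInner_smul {m : Type*} [Fintype m] (r : ℝ) (A B : Matrix m m ℝ) :
    matInner A (r • B) = r * matInner A B := by
  simp [matInner]

theorem smul_matInner {m : Type*} [Fintype m] (r : ℝ) (A B : Matrix m m ℝ) :
    matInner (r • A) B = r * matInner A B := by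
  simp [matInner]

/-! ### Equivalence of the conic and the primal semidefinite relaxation. -/

section SecondOrderCone

/-- The second-order cone constraint is the epigraph condition `xᵀQx ≤ t`. -/
theorem norm_le_iff {Q : Matrix (Fin n) (Fin n) ℝ} (hQ : Q.PosSemidef) (x : Fin n → ℝ) (t : ℝ) :
    ‖(WithLp.toLp 2 (Sum.elim ((CFC.sqrt Q).mulVec x) (fun _ => (t - 1) / 2)) :
      EuclideanSpace ℝ (Fin n ⊕ Unit))‖ ≤ (t + 1) / 2 ↔ x ⬝ᵥ Q *ᵥ x ≤ t := by
  have hs := (CFC.sqrt_nonneg Q).posSemidef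
  have h1 : (CFC.sqrt Q *ᵥ x) ⬝ᵥ (CFC.sqrt Q *ᵥ x) = x ⬝ᵥ Q *ᵥ x := by
    rw [dotProduct_mulVec, vecMul_mulVec, ← conjTranspose_eq_transpose_of_trivial, hs.1.eq,
      CFC.sqrt_mul_sqrt_self Q hQ.nonneg, ← mulVec_transpose,
      ← conjTranspose_eq_transpose_of_trivial, hQ.1.eq, dotProduct_comm]
  have h2 : ‖(WithLp.toLp 2 (Sum.elim ((CFC.sqrt Q).mulVec x) (fun _ => (t - 1) / 2)) :
      EuclideanSpace ℝ (Fin n ⊕ Unit))‖ ^ 2 = x ⬝ᵥ Q *ᵥ x + ((t - 1) / 2) ^ 2 := by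
    rw [EuclideanSpace.real_norm_sq_eq, ← h1]
    simp [Fintype.sum_sum_type, dotProduct, sq]
  have h0 : 0 ≤ x ⬝ᵥ Q *ᵥ x := by simpa using hQ.dotProduct_mulVec_nonneg x
  constructor
  · intro h
    have := pow_le_pow_left₀ (norm_nonneg _) h 2
    rw [h2] at this
    nlinarith
  · intro h
    refine le_of_sq_le_sq ?_ (by linarith)
    rw [h2]
    nlinarith

theorem socpFeasible_iff (hQ : P.Q.PosSemidef) (x : Fin n → ℝ) (t : ℝ) :
    P.SOCPFeasible x t ↔
      (∀ i, P.l i ≤ ((t + 2 * (P.b i ⬝ᵥ x) + P.d i : ℝ) : EReal) ∧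
        ((t + 2 * (P.b i ⬝ᵥ x) + P.d i : ℝ) : EReal) ≤ P.u i) ∧ x ⬝ᵥ P.Q *ᵥ x ≤ t := by
  rw [SOCPFeasible, norm_le_iff hQ]

theorem dotProduct_mulVec_add_smul {Q : Matrix (Fin n) (Fin n) ℝ} (hQ : Q.IsHermitian)
    (x w : Fin n → ℝ) (a : ℝ) :
    (x + a • w) ⬝ᵥ Q *ᵥ (x + a • w) =
      x ⬝ᵥ Q *ᵥ x + 2 * a * (w ⬝ᵥ Q *ᵥ x) + a ^ 2 * (w ⬝ᵥ Q *ᵥ w) := by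
  have h : x ⬝ᵥ Q *ᵥ w = w ⬝ᵥ Q *ᵥ x := by
    rw [dotProduct_mulVec, ← mulVec_transpose, ← conjTranspose_eq_transpose_of_trivial, hQ.eq,
      dotProduct_comm]
  simp only [mulVec_add, mulVec_smul, add_dotProduct, dotProduct_add, smul_dotProduct,
    dotProduct_smul, smul_eq_mul, h]
  ring

/-- The primal semidefinite relaxation and the second-order cone relaxation are equivalent:
`t` corresponds to `Q • Y`. -/
theorem valueSOCP_eq_valuePSDP (hn : 1 ≤ n) (hQ : P.Q.PosDef) : P.valueSOCP = P.valuePSDP := by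
  apply le_antisymm
  · refine iSup_le fun x => iSup_le fun t => iSup_le fun h => ?_
    rw [P.socpFeasible_iff hQ.posSemidef] at h
    obtain ⟨hc, ht⟩ := h
    -- The slack t - xᵀQx is put on one diagonal entry: Y = xxᵀ + r·eₖeₖᵀ, with r chosen so that Q •
    -- Y = t.
    let k : Fin n := ⟨0, hn⟩
    let E := vecMulVec (Pi.single k (1 : ℝ)) (Pi.single k 1)
    have hEp : E.PosSemidef := by
      simpa using posSemidef_vecMulVec_self_star (Pi.single k (1 : ℝ))
    have hE : matInner P.Q E = P.Q k k := by simp [E, matInner_vecMulVec]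
    have hk : 0 < P.Q k k := hQ.diag_pos
    let r := (t - x ⬝ᵥ P.Q *ᵥ x) / P.Q k k
    have hr : 0 ≤ r := div_nonneg (by linarith) hk.le
    let Y := vecMulVec x x + r • E
    have hY : matInner P.Q Y = t := by
      simp only [Y, matInner_add, matInner_smul, matInner_vecMulVec, hE, r]
      field_simp
      ring
    have key (v : Fin n → ℝ) (d : ℝ) :
        matInner (bordered P.Q v d) (bordered Y x 1) = t + 2 * (v ⬝ᵥ x) + d := by
      rw [matInner_bordered, hY, mul_one]
    have hfeas : P.PSDPFeasible Y x := by
      refine ⟨fun i => by simpa only [key] using hc i, ?_⟩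
      have hYh : Y.IsHermitian := by
        refine IsHermitian.add ?_ (hEp.smul hr).1
        simpa using (posSemidef_vecMulVec_self_star x).1
      refine .of_dotProduct_mulVec_nonneg (isHermitian_bordered _ _ _ hYh) fun z => ?_
      rw [star_trivial, dotProduct_bordered_mulVec, add_mulVec, dotProduct_add]
      have h1 := (hEp.smul hr).dotProduct_mulVec_nonneg (z ∘ Sum.inl)
      have h2 : (z ∘ Sum.inl) ⬝ᵥ vecMulVec x x *ᵥ (z ∘ Sum.inl) =
          (x ⬝ᵥ (z ∘ Sum.inl)) ^ 2 := by
        rw [vecMulVec_mulVec]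
        simp [dotProduct_comm, sq]
      rw [h2]
      rw [star_trivial] at h1
      nlinarith [sq_nonneg (x ⬝ᵥ (z ∘ Sum.inl) + z (Sum.inr ()))]
    refine le_iSup_of_le Y (le_iSup_of_le x (le_iSup_of_le hfeas ?_))
    rw [key]
  · refine iSup_le fun Y => iSup_le fun x => iSup_le fun h => ?_
    obtain ⟨hc, hY⟩ := h
    simp only [matInner_bordered, mul_one] at hc ⊢
    refine le_iSup_of_le x (le_iSup_of_le (matInner P.Q Y) (le_iSup_of_le ?_ le_rfl))
    rw [P.socpFeasible_iff hQ.posSemidef]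
    refine ⟨hc, ?_⟩
    -- This is the matrix of (z, r) ↦ (z - rx)ᵀQ(z - rx); its trace product with the bordered Y is Q
    -- • Y - xᵀQx.
    have hB : (bordered P.Q (-(P.Q *ᵥ x)) (x ⬝ᵥ P.Q *ᵥ x)).PosSemidef := by
      refine .of_dotProduct_mulVec_nonneg (isHermitian_bordered _ _ _ hQ.1) fun z => ?_
      rw [star_trivial, dotProduct_bordered_mulVec]
      have h := hQ.posSemidef.dotProduct_mulVec_nonneg (z ∘ Sum.inl + (-z (Sum.inr ())) • x)
      rw [star_trivial, dotProduct_mulVec_add_smul hQ.1] at h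
      have h2 : x ⬝ᵥ P.Q *ᵥ (z ∘ Sum.inl) = P.Q *ᵥ x ⬝ᵥ (z ∘ Sum.inl) := by
        rw [dotProduct_mulVec, ← mulVec_transpose, ← conjTranspose_eq_transpose_of_trivial,
          hQ.1.eq]
      rw [h2] at h
      rw [neg_dotProduct]
      linarith
    have h := matInner_nonneg hB hY
    rw [matInner_bordered, neg_dotProduct, dotProduct_comm (P.Q *ᵥ x)] at h
    linarith

end SecondOrderCone

/-! ### Tightness of the relaxation. -/

section Tightness

/-- A feasible point of the second-order cone relaxation can be moved onto the paraboloid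
`t = xᵀQx` along a direction that keeps all constraint values, without decreasing the
objective. -/
theorem value_eq_valueSOCP_of_direction (hQ : P.Q.PosDef) {w : Fin n → ℝ} {s : ℝ} (hw : w ≠ 0)
    (hb : ∀ i, s + 2 * (P.b i ⬝ᵥ w) = 0) : P.value = P.valueSOCP := by
  wlog h0 : 0 ≤ s + 2 * (P.b0 ⬝ᵥ w) generalizing w s
  · refine this (w := -w) (s := -s) (neg_ne_zero.2 hw) (fun i => ?_) ?_
    · rw [dotProduct_neg]; linarith [hb i]
    · rw [dotProduct_neg]; linarith
  apply le_antisymm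
  · refine iSup_le fun x => iSup_le fun h => ?_
    refine le_iSup_of_le x (le_iSup_of_le (x ⬝ᵥ P.Q *ᵥ x) (le_iSup_of_le ?_ le_rfl))
    rw [P.socpFeasible_iff hQ.posSemidef]
    exact ⟨h, le_rfl⟩
  · refine iSup_le fun x => iSup_le fun t => iSup_le fun h => ?_
    rw [P.socpFeasible_iff hQ.posSemidef] at h
    obtain ⟨hc, ht⟩ := h
    -- Here a is the larger root of qa² - (s - 2m)a - (t - c) = 0; it is nonnegative because c ≤ t.
    obtain ⟨a, ha, hat⟩ : ∃ a : ℝ, 0 ≤ a ∧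
        (x + a • w) ⬝ᵥ P.Q *ᵥ (x + a • w) = t + a * s := by
      simp only [dotProduct_mulVec_add_smul hQ.1]
      have hq : 0 < w ⬝ᵥ P.Q *ᵥ w := by simpa using hQ.dotProduct_mulVec_pos hw
      generalize w ⬝ᵥ P.Q *ᵥ w = q at *
      generalize w ⬝ᵥ P.Q *ᵥ x = m at *
      generalize x ⬝ᵥ P.Q *ᵥ x = c at *
      have hD : 0 ≤ (s - 2 * m) ^ 2 + 4 * q * (t - c) := by
        have := mul_nonneg hq.le (sub_nonneg.2 ht)
        nlinarith [sq_nonneg (s - 2 * m)]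
      have hr := Real.sq_sqrt hD
      have hr2 : |s - 2 * m| ≤ √((s - 2 * m) ^ 2 + 4 * q * (t - c)) := by
        apply Real.abs_le_sqrt
        have := mul_nonneg hq.le (sub_nonneg.2 ht)
        linarith
      generalize √((s - 2 * m) ^ 2 + 4 * q * (t - c)) = r at *
      refine ⟨((s - 2 * m) + r) / (2 * q), div_nonneg ?_ (by linarith), ?_⟩
      · linarith [(abs_le.1 hr2).1]
      · field_simp
        linear_combination hr
    have hval (v : Fin n → ℝ) (d : ℝ) :
        (x + a • w) ⬝ᵥ P.Q *ᵥ (x + a • w) + 2 * (v ⬝ᵥ (x + a • w)) + d =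
          t + 2 * (v ⬝ᵥ x) + d + a * (s + 2 * (v ⬝ᵥ w)) := by
      rw [hat, dotProduct_add, dotProduct_smul, smul_eq_mul]
      ring
    have hfeas : P.Feasible (x + a • w) := fun i => by
      rw [f, hval, hb, mul_zero, add_zero]
      exact hc i
    refine le_iSup_of_le (x + a • w) (le_iSup_of_le hfeas ?_)
    rw [EReal.coe_le_coe_iff, f0, hval]
    linarith [mul_nonneg ha h0]

/-- With deficient rank, s = 0 and w orthogonal to all `b i` will do. With p = n there are n linear
equations in the n + 1 unknowns (w, s). -/
theorem exists_direction (b : Fin p → Fin n → ℝ) (hn : 1 ≤ n)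
    (h : (Matrix.of b).transpose.rank ≤ n - 1 ∨ p = n) :
    ∃ (w : Fin n → ℝ) (s : ℝ), w ≠ 0 ∧ ∀ i, s + 2 * (b i ⬝ᵥ w) = 0 := by
  rcases h with h | rfl
  · rw [rank_transpose, Matrix.rank] at h
    have hrn := (Matrix.of b).mulVecLin.finrank_range_add_finrank_ker
    rw [Module.finrank_fin_fun] at hrn
    have hker : (Matrix.of b).mulVecLin.ker ≠ ⊥ := by
      intro h0
      rw [h0, finrank_bot] at hrn
      omega
    obtain ⟨w, hw, hw0⟩ := Submodule.exists_mem_ne_zero_of_ne_bot hker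
    refine ⟨w, 0, hw0, fun i => ?_⟩
    have := congrFun (LinearMap.mem_ker.1 hw) i
    simp only [mulVecLin_apply, mulVec, of_apply, Pi.zero_apply] at this
    rw [this]
    simp
  · let L : ((Fin p → ℝ) × ℝ) →ₗ[ℝ] (Fin p → ℝ) :=
      (2 : ℝ) • (Matrix.of b).mulVecLin ∘ₗ LinearMap.fst ℝ _ _ +
        (LinearMap.pi fun _ => LinearMap.id) ∘ₗ LinearMap.snd ℝ (Fin p → ℝ) ℝ
    have hker : L.ker ≠ ⊥ := LinearMap.ker_ne_bot_of_finrank_lt (by simp)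
    obtain ⟨⟨w, s⟩, hw, hw0⟩ := Submodule.exists_mem_ne_zero_of_ne_bot hker
    have hL (i : Fin p) : s + 2 * (b i ⬝ᵥ w) = 0 := by
      have := congrFun (LinearMap.mem_ker.1 hw) i
      rw [add_comm]
      simpa [L, mulVec] using this
    refine ⟨w, s, ?_, hL⟩
    -- If w = 0, any one equation (there is one, as 1 ≤ n) forces s = 0 as well.
    rintro rfl
    have := hL ⟨0, hn⟩
    simp at this
    simp [this] at hw0

end Tightness

end UQ

/-! ### Convex Lagrange duality by separation. -/

/-- Lagrange duality for a convex program: if a Slater point exists and `v` is a lower bound of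
the convex objective `f` over the strictly feasible points, then `v` is a lower bound of the
Lagrangian for some nonnegative multipliers. -/
theorem ConvexOn.exists_lagrange_multipliers {E ι : Type*} [AddCommGroup E] [Module ℝ E]
    [Fintype ι] {X : Set E} {f : E → ℝ} {g : ι → E → ℝ} (hf : ConvexOn ℝ X f)
    (hg : ∀ j, ConvexOn ℝ X (g j)) {v : ℝ} (hslater : ∃ z ∈ X, ∀ j, g j z < 0)
    (hv : ∀ z ∈ X, (∀ j, g j z < 0) → v ≤ f z) :
    ∃ μ : ι → ℝ, (∀ j, 0 ≤ μ j) ∧ ∀ z ∈ X, v ≤ f z + ∑ j, μ j * g j z := by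
  classical
  -- Strict inequalities make A a union of open boxes, so no continuity of f or g, nor a topology on
  -- E, is needed.
  let A : Set (ℝ × (ι → ℝ)) := {a | ∃ z ∈ X, f z < a.1 ∧ ∀ j, g j z < a.2 j}
  have hAc : Convex ℝ A := by
    rintro a ⟨z, hz, hza, hzg⟩ b ⟨z', hz', hzb, hzg'⟩ r s hr hs hrs
    have hlt {x y x' y' : ℝ} (h : x < x') (h' : y < y') : r * x + s * y < r * x' + s * y' := by
      rcases hr.eq_or_lt with rfl | hr
      · have : s = 1 := by linarith
        simp [this, h']
      · have := mul_lt_mul_of_pos_left h hr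
        have := mul_le_mul_of_nonneg_left h'.le hs
        linarith
    refine ⟨r • z + s • z', hf.1 hz hz' hr hs hrs, ?_, fun j => ?_⟩
    · exact (hf.2 hz hz' hr hs hrs).trans_lt (hlt hza hzb)
    · exact ((hg j).2 hz hz' hr hs hrs).trans_lt (hlt (hzg j) (hzg' j))
  have hAo : IsOpen A := by
    have : A = ⋃ z ∈ X, {a : ℝ × (ι → ℝ) | f z < a.1} ∩ ⋂ j, {a | g j z < a.2 j} := by
      ext a
      simp only [A, Set.mem_ofPred_eq, Set.mem_iUnion, Set.mem_inter_iff, Set.mem_iInter,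
        exists_prop]
    rw [this]
    refine isOpen_biUnion fun z _ => ?_
    refine (isOpen_lt (by fun_prop) (by fun_prop)).inter (isOpen_iInter_of_finite fun j => ?_)
    exact isOpen_lt (by fun_prop) (by fun_prop)
  have hA0 : (v, (0 : ι → ℝ)) ∉ A := by
    rintro ⟨z, hz, h1, h2⟩
    exact absurd (hv z hz h2) (not_le.2 h1)
  obtain ⟨φ, hφ⟩ := geometric_hahn_banach_open_point hAc hAo hA0
  let ρ := -φ (1, 0)
  let μ : ι → ℝ := fun j => -φ (0, Pi.single j 1)
  have hφe (a : ℝ × (ι → ℝ)) : φ a = -(a.1 * ρ + ∑ j, μ j * a.2 j) := by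
    have ha : a = a.1 • ((1 : ℝ), (0 : ι → ℝ)) +
        ∑ j, a.2 j • ((0 : ℝ), (Pi.single j (1 : ℝ) : ι → ℝ)) := by
      ext i
      · simp [Prod.fst_sum]
      · simp [Prod.snd_sum, Finset.sum_apply, Pi.single_apply]
    conv_lhs => rw [ha]
    simp only [map_add, map_smul, map_sum, ρ, μ, smul_eq_mul]
    rw [neg_add, ← Finset.sum_neg_distrib]
    congr 1
    · ring
    · exact Finset.sum_congr rfl fun j _ => by ring
  have hsep : ∀ a ∈ A, v * ρ < a.1 * ρ + ∑ j, μ j * a.2 j := fun a ha => by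
    have := hφ a ha
    rw [hφe, hφe] at this
    simpa using this
  obtain ⟨z0, hz0, hz0g⟩ := hslater
  -- A is closed upward in each coordinate, so a negative coefficient would break the separation far
  -- along a ray.
  have hnonneg {x y c : ℝ} (h : ∀ T : ℝ, 0 ≤ T → x < y + T * c) : 0 ≤ c := by
    by_contra! hc
    have h1 := h (|y - x| / -c) (div_nonneg (abs_nonneg _) (by linarith))
    have h2 : |y - x| / -c * c = -|y - x| := by
      rw [div_neg, neg_mul, div_mul_cancel₀ _ hc.ne]
    rw [h2] at h1
    linarith [le_abs_self (y - x)]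
  have hρ0 : 0 ≤ ρ := hnonneg (x := v * ρ) (y := (f z0 + 1) * ρ) fun T hT => by
    have := hsep (f z0 + 1 + T, 0) ⟨z0, hz0, by simp; linarith, hz0g⟩
    simp only [Pi.zero_apply, mul_zero, Finset.sum_const_zero, add_zero] at this
    linarith
  have hμ0 (j : ι) : 0 ≤ μ j := hnonneg (x := v * ρ) (y := (f z0 + 1) * ρ) fun T hT => by
    have := hsep (f z0 + 1, T • Pi.single j 1) ⟨z0, hz0, by simp, fun i => by
      have : 0 ≤ (Pi.single j (1 : ℝ) : ι → ℝ) i := by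
        rw [Pi.single_apply]; split_ifs <;> simp
      exact (hz0g i).trans_le (mul_nonneg hT this)⟩
    simp only [Pi.smul_apply, Pi.single_apply, smul_eq_mul, mul_ite, mul_one, mul_zero,
      Finset.sum_ite_eq', Finset.mem_univ, if_true] at this
    linarith
  -- If ρ = 0, the Slater point puts (f z0 + 1, 0) in A, and separation reads 0 < 0.
  have hρ : 0 < ρ := by
    refine hρ0.lt_of_ne fun h => ?_
    have := hsep (f z0 + 1, 0) ⟨z0, hz0, by simp, hz0g⟩
    simp [← h] at this
  refine ⟨fun j => μ j / ρ, fun j => div_nonneg (hμ0 j) hρ0, fun z hz => ?_⟩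
  have hz' : v * ρ ≤ f z * ρ + ∑ j, μ j * g j z := by
    -- The point (f z, g z) is only on the boundary of A; shifting all coordinates by δ enters A at
    -- total cost ε.
    refine le_of_forall_pos_le_add fun ε hε => ?_
    let δ := ε / (ρ + ∑ j, μ j)
    have hS : 0 < ρ + ∑ j, μ j := add_pos_of_pos_of_nonneg hρ (Finset.sum_nonneg fun j _ => hμ0 j)
    have hδ : 0 < δ := div_pos hε hS
    have h := hsep (f z + δ, fun j => g j z + δ) ⟨z, hz, by simpa, fun j => by simpa⟩
    simp only [mul_add, Finset.sum_add_distrib, add_mul, ← Finset.sum_mul] at h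
    have : δ * (ρ + ∑ j, μ j) = ε := div_mul_cancel₀ _ hS.ne'
    linarith
  have hs : ∑ j, μ j / ρ * g j z = (∑ j, μ j * g j z) / ρ := by
    rw [Finset.sum_div]
    exact Finset.sum_congr rfl fun j _ => by ring
  rw [hs, ← sub_le_iff_le_add', le_div_iff₀ hρ]
  linarith

/-! ### Duality with the semidefinite dual. -/

namespace UQ

variable {n p : ℕ} (P : UQ n p)

theorem coe_sum_ereal {ι : Type*} (s : Finset ι) (g : ι → ℝ) :
    ((∑ i ∈ s, g i : ℝ) : EReal) = ∑ i ∈ s, (g i : EReal) := by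
  classical
  induction s using Finset.induction_on with
  | empty => simp
  | insert a s ha ih => rw [Finset.sum_insert ha, Finset.sum_insert ha, EReal.coe_add, ih]

/-- The dual matrix as a bordered matrix. -/
theorem dual_matrix_eq (τ : ℝ) (y : Fin p → ℝ) :
    (∑ i, y i • bordered P.Q (P.b i) (P.d i)) - bordered P.Q P.b0 P.d0 + bordered 0 0 τ =
      bordered ((∑ i, y i - 1) • P.Q) (∑ i, y i • P.b i - P.b0)
        (∑ i, y i * P.d i - P.d0 + τ) := by
  ext (i | i) (j | j) <;>
    simp [bordered, Matrix.sum_apply, Finset.sum_mul, sub_mul]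

/-- Nonnegativity of the Lagrangian on the epigraph of `xᵀQx` yields a semidefinite matrix. -/
theorem posSemidef_bordered_of_nonneg {Q : Matrix (Fin n) (Fin n) ℝ} (hQ : Q.PosSemidef)
    {c e : ℝ} {w : Fin n → ℝ}
    (h : ∀ (x : Fin n → ℝ) (t : ℝ), x ⬝ᵥ Q *ᵥ x ≤ t → 0 ≤ c * t + 2 * (w ⬝ᵥ x) + e) :
    (bordered (c • Q) w e).PosSemidef := by
  have hc : 0 ≤ c := by
    by_contra! hc
    have h1 := h 0 ((|e| + 1) / -c) (by
      simpa using div_nonneg (by positivity) (by linarith))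
    have h2 : c * ((|e| + 1) / -c) = -(|e| + 1) := by
      rw [div_neg, mul_neg, mul_div_cancel₀ _ hc.ne]
    rw [h2, dotProduct_zero] at h1
    linarith [le_abs_self e]
  refine .of_dotProduct_mulVec_nonneg (isHermitian_bordered _ _ _ (hQ.smul hc).1) fun z => ?_
  rw [star_trivial, dotProduct_bordered_mulVec, smul_mulVec, dotProduct_smul, smul_eq_mul]
  generalize z ∘ Sum.inl = x
  generalize z (Sum.inr ()) = r
  rcases eq_or_ne r 0 with rfl | hr
  · have := hQ.dotProduct_mulVec_nonneg x
    rw [star_trivial] at this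
    simpa using mul_nonneg hc this
  -- Homogenization: the form at (x, r) is r² times the affine function at x/r, with t on the
  -- paraboloid.
  · have h1 := mul_nonneg (sq_nonneg r) (h (r⁻¹ • x) _ le_rfl)
    simp only [mulVec_smul, smul_dotProduct, dotProduct_smul, smul_eq_mul] at h1
    convert h1 using 1
    field_simp

/-- Each weighted constraint value is bounded by the matching term of the dual objective. -/
theorem coe_mul_le_dual_term {l u : EReal} {g : ℝ} (hl : l ≤ g) (hu : (g : EReal) ≤ u) (y : ℝ) :
    ((y * g : ℝ) : EReal) ≤
      ((max y 0 : ℝ) : EReal) * u - ((-min y 0 : ℝ) : EReal) * l := by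
  rcases le_total 0 y with hy | hy
  · rw [max_eq_left hy, min_eq_right hy, EReal.coe_mul]
    simpa using mul_le_mul_of_nonneg_left hu (EReal.coe_nonneg.2 hy)
  · rw [max_eq_right hy, min_eq_left hy]
    have h := mul_le_mul_of_nonneg_left hl (EReal.coe_nonneg.2 (neg_nonneg.2 hy))
    have h2 := EReal.neg_le_neg_iff.2 h
    rw [← EReal.coe_mul, ← EReal.coe_neg] at h2
    simpa using h2

/-- Each term of the dual objective is bounded by its value at any splitting `y = a - b` of the
multiplier into nonnegative parts that vanish at infinite bounds. -/
theorem dual_term_le_coe {l u : EReal} (hlu : l < u) {a b : ℝ} (ha : 0 ≤ a) (hb : 0 ≤ b)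
    (hau : u = ⊤ → a = 0) (hbl : l = ⊥ → b = 0) :
    ((max (a - b) 0 : ℝ) : EReal) * u - ((-min (a - b) 0 : ℝ) : EReal) * l ≤
      ((a * u.toReal - b * l.toReal : ℝ) : EReal) := by
  induction u with
  | bot => simp at hlu
  | top =>
    obtain rfl := hau rfl
    induction l with
    | bot => obtain rfl := hbl rfl; simp
    | top => simp at hlu
    | coe l =>
      simp only [zero_sub, max_eq_right (neg_nonpos.2 hb), min_eq_left (neg_nonpos.2 hb)]
      rw [← EReal.coe_mul]
      simp
  | coe u =>
    induction l with
    | bot =>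
      obtain rfl := hbl rfl
      simp only [sub_zero, max_eq_left ha, min_eq_right ha]
      rw [← EReal.coe_mul]
      simp
    | top => simp at hlu
    | coe l =>
      rw [← EReal.coe_mul, ← EReal.coe_mul, ← EReal.coe_sub, EReal.coe_le_coe_iff,
        EReal.toReal_coe, EReal.toReal_coe]
      have h := EReal.coe_lt_coe_iff.1 hlu
      -- Cancelling the common part of a and b saves min(a, b)·(u - l) ≥ 0.
      rcases le_total a b with hab | hab
      · rw [max_eq_right (by linarith), min_eq_left (by linarith)]
        nlinarith [mul_nonneg ha (sub_nonneg.2 h.le)]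
      · rw [max_eq_left (by linarith), min_eq_right (by linarith)]
        nlinarith [mul_nonneg hb (sub_nonneg.2 h.le)]

theorem sum_matInner {m ι : Type*} [Fintype m] (s : Finset ι) (A : ι → Matrix m m ℝ)
    (B : Matrix m m ℝ) : matInner (∑ i ∈ s, A i) B = ∑ i ∈ s, matInner (A i) B := by
  simp [matInner, Finset.sum_mul, trace_sum]

/-- Weak duality. -/
theorem valuePSDP_le_valueDSDP : P.valuePSDP ≤ P.valueDSDP := by
  refine iSup_le fun Y => iSup_le fun x => iSup_le fun h => ?_
  refine le_iInf fun τ => le_iInf fun y => le_iInf fun hy => ?_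
  obtain ⟨hc, hY⟩ := h
  have h0 := matInner_nonneg hy hY
  rw [add_matInner, sub_eq_add_neg, add_matInner, ← neg_one_smul ℝ, smul_matInner, sum_matInner,
    matInner_bordered 0] at h0
  simp only [smul_matInner] at h0
  have hz : matInner 0 Y = 0 := by simp [matInner]
  rw [hz, zero_dotProduct] at h0
  set g := fun i => matInner (bordered P.Q (P.b i) (P.d i)) (bordered Y x 1)
  have h1 : matInner (bordered P.Q P.b0 P.d0) (bordered Y x 1) ≤ τ + ∑ i, y i * g i := by
    linarith
  refine (EReal.coe_le_coe_iff.2 h1).trans ?_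
  rw [EReal.coe_add, coe_sum_ereal, dualObj]
  gcongr with i
  exact coe_mul_le_dual_term (hc i).1 (hc i).2 (y i)

/-- Strong duality between the second-order cone relaxation and the dual semidefinite problem. -/
theorem valueDSDP_le_valueSOCP (hQ : P.Q.PosDef) (hS : P.Slater) :
    P.valueDSDP ≤ P.valueSOCP := by
  obtain ⟨x0, hx0⟩ := hS
  have hlu (i : Fin p) : P.l i < P.u i := (hx0 i).1.trans (hx0 i).2
  have hmem {x : Fin n → ℝ} {t : ℝ} (h : P.SOCPFeasible x t) :
      ((t + 2 * (P.b0 ⬝ᵥ x) + P.d0 : ℝ) : EReal) ≤ P.valueSOCP :=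
    le_iSup_of_le x (le_iSup_of_le t (le_iSup_of_le h le_rfl))
  have hbot : P.valueSOCP ≠ ⊥ := by
    refine ne_bot_of_le_ne_bot (EReal.coe_ne_bot _) (hmem (x := x0) (t := x0 ⬝ᵥ P.Q *ᵥ x0) ?_)
    rw [P.socpFeasible_iff hQ.posSemidef]
    exact ⟨fun i => ⟨(hx0 i).1.le, (hx0 i).2.le⟩, le_rfl⟩
  rcases eq_or_ne P.valueSOCP ⊤ with htop | htop
  · rw [htop]
    exact le_top
  obtain ⟨v, hv⟩ : ∃ v : ℝ, P.valueSOCP = v :=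
    ⟨P.valueSOCP.toReal, (EReal.coe_toReal htop hbot).symm⟩
  let X : Set ((Fin n → ℝ) × ℝ) := {z | z.1 ⬝ᵥ P.Q *ᵥ z.1 ≤ z.2}
  let aff (b : Fin n → ℝ) : ((Fin n → ℝ) × ℝ) →ₗ[ℝ] ℝ :=
    LinearMap.snd ℝ _ _ + (2 : ℝ) • (dotProductBilin ℝ ℝ b) ∘ₗ LinearMap.fst ℝ _ _
  have haff (b : Fin n → ℝ) (z : (Fin n → ℝ) × ℝ) : aff b z = z.2 + 2 * (b ⬝ᵥ z.1) := by
    simp [aff]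
  have hX : Convex ℝ X := by
    rintro ⟨x, t⟩ hx ⟨x', t'⟩ hx' r s hr hs hrs
    simp only [X, Set.mem_ofPred_eq] at hx hx'
    change (r • x + s • x') ⬝ᵥ P.Q *ᵥ (r • x + s • x') ≤ r * t + s * t'
    have h0 := hQ.posSemidef.dotProduct_mulVec_nonneg (x + (-1 : ℝ) • x')
    rw [star_trivial, dotProduct_mulVec_add_smul hQ.1] at h0
    rw [dotProduct_mulVec_add_smul hQ.1]
    simp only [mulVec_smul, smul_dotProduct, dotProduct_smul, smul_eq_mul]
    have hr' : r = 1 - s := by linarith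
    -- The convexity defect of xᵀQx is rs·(x - x')ᵀQ(x - x').
    have h1 := mul_le_mul_of_nonneg_left hx hr
    have h2 := mul_le_mul_of_nonneg_left hx' hs
    have h3 := mul_nonneg (mul_nonneg hr hs) h0
    subst hr'
    linarith
  have hconv (b : Fin n → ℝ) : ConvexOn ℝ X (aff b) := (aff b).convexOn hX
  have hconc (b : Fin n → ℝ) : ConvexOn ℝ X (-aff b) := (-aff b).convexOn hX
  -- An infinite bound becomes the vacuous constraint -1 < 0. The cone constraint stays in X, so the
  -- Slater point may lie on the paraboloid.
  let g : Fin p ⊕ Fin p → ((Fin n → ℝ) × ℝ) → ℝ := Sum.elim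
    (fun i z => if P.u i = ⊤ then -1 else aff (P.b i) z + (P.d i - (P.u i).toReal))
    (fun i z => if P.l i = ⊥ then -1 else (-aff (P.b i)) z + ((P.l i).toReal - P.d i))
  have hg (j) : ConvexOn ℝ X (g j) := by
    rcases j with i | i <;> simp only [g, Sum.elim_inl, Sum.elim_inr]
    · split_ifs
      · exact convexOn_const _ hX
      · exact (hconv _).add_const _
    · split_ifs
      · exact convexOn_const _ hX
      · exact (hconc _).add_const _
  have hgneg (z : (Fin n → ℝ) × ℝ) : (∀ j, g j z < 0) ↔
      ∀ i, P.l i < ((z.2 + 2 * (P.b i ⬝ᵥ z.1) + P.d i : ℝ) : EReal) ∧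
        ((z.2 + 2 * (P.b i ⬝ᵥ z.1) + P.d i : ℝ) : EReal) < P.u i := by
    rw [Sum.forall, ← forall_and]
    refine forall_congr' fun i => ?_
    rw [and_comm]
    refine and_congr ?_ ?_
    · simp only [g, Sum.elim_inr, LinearMap.neg_apply, haff]
      split_ifs with h
      · simp only [h, EReal.bot_lt_coe, iff_true]; norm_num
      · conv_rhs => rw [← EReal.coe_toReal ((hlu i).trans_le le_top).ne h, EReal.coe_lt_coe_iff]
        constructor <;> intro <;> linarith
    · simp only [g, Sum.elim_inl, haff]
      split_ifs with h
      · simp only [h, EReal.coe_lt_top, iff_true]; norm_num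
      · conv_rhs => rw [← EReal.coe_toReal h (bot_le.trans_lt (hlu i)).ne', EReal.coe_lt_coe_iff]
        constructor <;> intro <;> linarith
  obtain ⟨μ, hμ0, hμ⟩ := ((hconc P.b0).add_const (-P.d0)).exists_lagrange_multipliers hg (v := -v)
    ⟨(x0, x0 ⬝ᵥ P.Q *ᵥ x0), le_refl (x0 ⬝ᵥ P.Q *ᵥ x0), (hgneg _).2 hx0⟩ fun z hz hzg => by
      rw [hgneg] at hzg
      have := hmem ((P.socpFeasible_iff hQ.posSemidef z.1 z.2).2
        ⟨fun i => ⟨(hzg i).1.le, (hzg i).2.le⟩, hz⟩)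
      rw [hv, EReal.coe_le_coe_iff] at this
      simp only [Pi.add_apply, LinearMap.neg_apply, haff]
      linarith
  -- Dropping the multipliers of vacuous constraints only raises the Lagrangian, as each contributed
  -- -μ ≤ 0.
  let a : Fin p → ℝ := fun i => if P.u i = ⊤ then 0 else μ (Sum.inl i)
  let b : Fin p → ℝ := fun i => if P.l i = ⊥ then 0 else μ (Sum.inr i)
  have ha (i) : 0 ≤ a i := by simp only [a]; split_ifs; exacts [le_rfl, hμ0 _]
  have hb (i) : 0 ≤ b i := by simp only [b]; split_ifs; exacts [le_rfl, hμ0 _]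
  let κ := ∑ i, (a i * (P.u i).toReal - b i * (P.l i).toReal)
  let y : Fin p → ℝ := fun i => a i - b i
  -- τ = v - κ cancels the bound terms, so the dual objective is at most v.
  have hdual : P.DSDPFeasible (v - κ) y := by
    rw [DSDPFeasible, dual_matrix_eq]
    refine posSemidef_bordered_of_nonneg hQ.posSemidef fun x t ht => ?_
    have h1 := hμ (x, t) ht
    rw [Fintype.sum_sum_type, ← Finset.sum_add_distrib] at h1
    have h2 : ∑ i, (μ (Sum.inl i) * g (Sum.inl i) (x, t) + μ (Sum.inr i) * g (Sum.inr i) (x, t)) ≤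
        (∑ i, y i) * t + 2 * ∑ i, y i * (P.b i ⬝ᵥ x) + ∑ i, y i * P.d i - κ := by
      rw [Finset.sum_mul, Finset.mul_sum, ← Finset.sum_add_distrib, ← Finset.sum_add_distrib,
        ← Finset.sum_sub_distrib]
      refine Finset.sum_le_sum fun i _ => ?_
      have hu : μ (Sum.inl i) * g (Sum.inl i) (x, t) ≤
          a i * (t + 2 * (P.b i ⬝ᵥ x) + P.d i - (P.u i).toReal) := by
        simp only [g, Sum.elim_inl, haff, a]
        split_ifs
        · linarith [hμ0 (Sum.inl i)]
        · apply le_of_eq; ring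
      have hl : μ (Sum.inr i) * g (Sum.inr i) (x, t) ≤
          b i * ((P.l i).toReal - (t + 2 * (P.b i ⬝ᵥ x) + P.d i)) := by
        simp only [g, Sum.elim_inr, LinearMap.neg_apply, haff, b]
        split_ifs
        · linarith [hμ0 (Sum.inr i)]
        · apply le_of_eq; ring
      simp only [y]
      linarith
    simp only [Pi.add_apply, LinearMap.neg_apply, haff] at h1
    simp only [sub_dotProduct, sum_dotProduct, smul_dotProduct, smul_eq_mul]
    linarith
  refine iInf_le_of_le (v - κ) (iInf_le_of_le y (iInf_le_of_le hdual ?_))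
  have hobj : P.dualObj (v - κ) y ≤ ((v - κ : ℝ) : EReal) + (κ : EReal) := by
    rw [dualObj, coe_sum_ereal]
    gcongr with i
    exact dual_term_le_coe (hlu i) (ha i) (hb i) (fun h => by simp [a, h])
      fun h => by simp [b, h]
  rw [hv]
  refine hobj.trans (le_of_eq ?_)
  rw [← EReal.coe_add, sub_add_cancel]

end UQ

theorem theorem2 (n p : ℕ) (hn : 1 ≤ n) (P : UQ n p) (hQ : P.Q.PosDef)
    (hSlater : P.Slater) (hfin : P.value < ⊤) :
    (P.valueSOCP = P.valuePSDP ∧ P.valuePSDP = P.valueDSDP) ∧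
    (((Matrix.of P.b).transpose.rank ≤ n - 1 ∨ p = n) → P.value = P.valueDSDP) := by
  have h1 := P.valueSOCP_eq_valuePSDP hn hQ
  have h2 : P.valuePSDP = P.valueDSDP :=
    le_antisymm P.valuePSDP_le_valueDSDP ((P.valueDSDP_le_valueSOCP hQ hSlater).trans_eq h1)
  refine ⟨⟨h1, h2⟩, fun h => ?_⟩
  obtain ⟨w, s, hw, hb⟩ := UQ.exists_direction P.b hn h
  rw [P.value_eq_valueSOCP_of_direction hQ hw hb, h1, h2]
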